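/- Let $K\ge 2$ and $N\ge 2$ be integers, let $F_{\mathrm s}>0$, and for $k=1,\dots,K$ let $d_k\ge 0$, $f_k\in[0,F_{\mathrm s})$ and $z_k := e^{-d_k}e^{2\pi i f_k/F_{\mathrm s}}$. Put $$\delta := \min_{n\in\mathbb Z}\ \min_{\substack{1\le k,\ell\le K\\ k\ne \ell}} |f_k-f_\ell+nF_{\mathrm s}|,\qquad d_{\max}:=\max_{1\le k\le K} d_k ,$$ and let $V_N := (z_k^{\,n})_{0\le n\le N-1,\ 1\le k\le K}\in\mathbb C^{N\times K}$ be the Vandermonde matrix with nodes $z_1,\dots,z_K$. Denote by $\sigma_{\min}(V_N)$ and $\sigma_{\max}(V_N)$ the smallest and the largest of its $\min(N,K)$ singular values, and by $\kappa(V_N):=\sigma_{\max}(V_N)/\sigma_{\min}(V_N)$ its condition number. If $$d_{\max}<\frac1{N-1}\qquad\text{and}\qquad \delta>\frac{84F_{\mathrm s}}{\pi(N-1)\big(1-d_{\max}(N-1)\big)},$$ then $$\sigma_{\min}^2(V_N)\ \ge\ (N-1)\big(1-d_{\max}(N-1)\big)-\frac{84F_{\mathrm s}}{\pi\delta},\qquad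 \sigma_{\max}^2(V_N)\ \le\ N-1+\frac{84F_{\mathrm s}}{\pi\delta},$$ and thus $\sigma_{\min}(V_N)>0$ and $$\kappa(V_N)\ \le\ \sqrt{\frac{N-1+84F_{\mathrm s}/(\pi\delta)}{(N-1)\big(1-d_{\max}(N-1)\big)-84F_{\mathrm s}/(\pi\delta)}} .$$ -/

import Mathlib

noncomputable section

/-- The node `e^{-d} e^{2πi f / F_s}` with damping factor `d`, frequency `f` and sampling
frequency `F_s`. -/
def dampedNode (Fs d f : ℝ) : ℂ :=
  Complex.exp (-(d : ℂ)) * Complex.exp (2 * Real.pi * Complex.I * f / Fs)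

/-- The `L × K` Vandermonde matrix with nodes `z_1, …, z_K`: its row number `n`
(for `n = 0, …, L - 1`) is `(z_1 ^ n, …, z_K ^ n)`. -/
def vandermondeMatrix (L : ℕ) {K : ℕ} (z : Fin K → ℂ) : Matrix (Fin L) (Fin K) ℂ :=
  Matrix.of fun n k => z k ^ (n : ℕ)

/-- The set of all wrap-around distances `|f_k - f_ℓ + n F_s|`, with `n` an integer and
`k ≠ ℓ`. -/
def wrapDistances {K : ℕ} (Fs : ℝ) (f : Fin K → ℝ) : Set ℝ :=
  {r | ∃ (n : ℤ) (k l : Fin K), k ≠ l ∧ r = |f k - f l + n * Fs|}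

/-- The largest singular value of an `M × N` complex matrix, seen as a linear map between
Euclidean spaces (Mathlib lists the singular values in decreasing order, starting at
index `0`). -/
def sigmaMax {M N : ℕ} (A : Matrix (Fin M) (Fin N) ℂ) : ℝ :=
  (Matrix.toLpLin 2 2 A).singularValues 0

/-- The smallest of the `min M N` singular values of an `M × N` complex matrix. -/
def sigmaMin {M N : ℕ} (A : Matrix (Fin M) (Fin N) ℂ) : ℝ :=
  (Matrix.toLpLin 2 2 A).singularValues (min M N - 1)

/-- The spectral condition number `σ_max / σ_min`. -/
def condNumber {M N : ℕ} (A : Matrix (Fin M) (Fin N) ℂ) : ℝ :=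
  sigmaMax A / sigmaMin A

end

/-! With `s n = ∑ k, x k * z k ^ n`, the square norm of `V_N x` is the sum of `‖s n‖ ^ 2` over a
window of length `N`. The Gram matrix of this sharp window decays only like `1 / ‖1 - ζ‖`, where `ζ
= z k * star (z l)`, so its rows are not uniformly summable. The window is therefore replaced by the
trapezoid obtained by convolving windows of lengths `L` and `M`. The Gram entries become products of
two geometric sums, at most `4 / ‖1 - ζ‖ ^ 2`; separation of the frequencies then bounds every
off-diagonal row sum by `B = 8 (Fs / δ) ^ 2`, and Schur's test applies.

A trapezoid of height `L` below the sharp window gives the lower bound, one equal to its height on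
the window gives the upper bound. Dividing by the height turns `B` into `B / L`, while the sloping
edges cost about `L`; `L ≈ Fs / δ` balances the two, and the total loss is of order `Fs / δ`.
Damping enters through the diagonal (below) and through a shift of the window (above).

The carrying lemmas are `abs_weighted_sum_sub_diagonal_le`, `dampedNode_row_sum_le`,
`le_sum_norm_sq_of_row_sums` and `sum_norm_sq_le_of_row_sums`. -/

open Finset in
/-- Reciprocal squares of `η`-separated reals, all at least `η`, sum to at most `2 / η²`. -/
theorem sum_inv_sq_le_of_separated {ι : Type*} (s : Finset ι) (v : ι → ℝ) {η : ℝ} (hη : 0 < η)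
    (hv : ∀ l ∈ s, η ≤ v l) (hsep : ∀ l ∈ s, ∀ m ∈ s, l ≠ m → η ≤ |v l - v m|) :
    ∑ l ∈ s, (v l ^ 2)⁻¹ ≤ 2 / η ^ 2 := by
  -- Separated values lie in different cells `[nη, (n+1)η)`, so the floors are distinct positive
  -- integers and the sum is dominated by `∑ 1 / n ^ 2 ≤ 2`.
  set p : ι → ℕ := fun l => ⌊v l / η⌋₊ with hp
  have hp1 : ∀ l ∈ s, 1 ≤ p l := fun l hl => by
    rw [hp, Nat.one_le_floor_iff, le_div_iff₀ hη, one_mul]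
    exact hv l hl
  have hple : ∀ l ∈ s, (p l : ℝ) * η ≤ v l := fun l hl => by
    rw [← le_div_iff₀ hη]
    exact Nat.floor_le (div_nonneg (hη.le.trans (hv l hl)) hη.le)
  have hplt : ∀ l, v l < (p l + 1 : ℝ) * η := fun l => by
    rw [← div_lt_iff₀ hη]
    exact Nat.lt_floor_add_one _
  have hinj : Set.InjOn p s := by
    intro l hl m hm hlm
    by_contra hne
    have h := hsep l hl m hm hne
    have h1 := hple l hl
    have h2 := hple m hm
    have h3 := hplt l
    have h4 := hplt m
    rw [hlm] at h1 h3
    have : |v l - v m| < η := abs_lt.2 ⟨by linarith, by linarith⟩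
    linarith
  calc ∑ l ∈ s, (v l ^ 2)⁻¹ ≤ ∑ l ∈ s, (((p l : ℝ) ^ 2)⁻¹) * (η ^ 2)⁻¹ := by
        refine sum_le_sum fun l hl => ?_
        rw [← mul_inv, ← mul_pow]
        have : (0 : ℝ) < p l := by exact_mod_cast hp1 l hl
        have := hple l hl
        gcongr
    _ = (∑ n ∈ s.image p, (((n : ℕ) : ℝ) ^ 2)⁻¹) * (η ^ 2)⁻¹ := by
        rw [sum_image hinj, sum_mul]
    _ ≤ (∑ n ∈ Ioo 0 ((s.image p).sup id + 1), ((n : ℝ) ^ 2)⁻¹) * (η ^ 2)⁻¹ := by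
        gcongr
        intro n hn
        obtain ⟨l, hl, rfl⟩ := mem_image.1 hn
        exact mem_Ioo.2 ⟨hp1 l hl, Nat.lt_succ_of_le (le_sup (f := id) hn)⟩
    _ ≤ 2 * (η ^ 2)⁻¹ := by
        gcongr
        simpa using sum_Ioo_inv_sq_le (α := ℝ) 0 ((s.image p).sup id + 1)
    _ = 2 / η ^ 2 := by rw [div_eq_mul_inv]

open Finset in
/-- Two-sided version of `sum_inv_sq_le_of_separated`. -/
theorem sum_inv_sq_le_of_abs_separated {ι : Type*} (s : Finset ι) (v : ι → ℝ) {η : ℝ}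
    (hη : 0 < η) (hv : ∀ l ∈ s, η ≤ |v l|)
    (hsep : ∀ l ∈ s, ∀ m ∈ s, l ≠ m → η ≤ |v l - v m|) :
    ∑ l ∈ s, (v l ^ 2)⁻¹ ≤ 4 / η ^ 2 := by
  classical
  rw [← sum_filter_add_sum_filter_not s (fun l => 0 ≤ v l)]
  have h1 : ∑ l ∈ s with 0 ≤ v l, (v l ^ 2)⁻¹ ≤ 2 / η ^ 2 := by
    refine sum_inv_sq_le_of_separated _ _ hη (fun l hl => ?_) fun l hl m hm hne => ?_
    · rw [mem_filter] at hl
      simpa [abs_of_nonneg hl.2] using hv l hl.1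
    · exact hsep l (mem_filter.1 hl).1 m (mem_filter.1 hm).1 hne
  have h2 : ∑ l ∈ s with ¬ 0 ≤ v l, ((-v l) ^ 2)⁻¹ ≤ 2 / η ^ 2 := by
    refine sum_inv_sq_le_of_separated _ (fun l => -v l) hη (fun l hl => ?_)
      fun l hl m hm hne => ?_
    · rw [mem_filter, not_le] at hl
      simpa [abs_of_neg hl.2] using hv l hl.1
    · rw [neg_sub_neg, abs_sub_comm]
      exact hsep l (mem_filter.1 hl).1 m (mem_filter.1 hm).1 hne
  simp only [neg_sq] at h2
  calc _ ≤ 2 / η ^ 2 + 2 / η ^ 2 := add_le_add h1 h2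
    _ = 4 / η ^ 2 := by ring

/-! ### Schur's test and the trapezoidal Gram matrix -/

/-- A Hermitian form whose matrix is close to diagonal in the sense of Schur's test. -/
theorem abs_sub_diagonal_le_of_row_sums {ι : Type*} [Fintype ι] [DecidableEq ι] (x : ι → ℂ)
    (g : ι → ι → ℂ) (D : ι → ℝ) (c : ι → ι → ℝ) (Q B : ℝ)
    (hQ : (Q : ℂ) = ∑ k, ∑ l, x k * star (x l) * g k l)
    (hg : ∀ k l, ‖g k l - if k = l then (D k : ℂ) else 0‖ ≤ c k l)
    (hc : ∀ k l, c k l = c l k) (hB : ∀ k, ∑ l, c k l ≤ B) :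
    |Q - ∑ k, D k * ‖x k‖ ^ 2| ≤ B * ∑ k, ‖x k‖ ^ 2 := by
  have hc0 : ∀ k l, 0 ≤ c k l := fun k l => (norm_nonneg _).trans (hg k l)
  have hdiff : ((Q - ∑ k, D k * ‖x k‖ ^ 2 : ℝ) : ℂ) =
      ∑ k, ∑ l, x k * star (x l) * (g k l - if k = l then (D k : ℂ) else 0) := by
    simp only [mul_sub, Finset.sum_sub_distrib, ← hQ, mul_ite, mul_zero, Finset.sum_ite_eq,
      Finset.mem_univ, if_true]
    push_cast
    congr 1
    refine Finset.sum_congr rfl fun k _ => ?_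
    rw [mul_comm, ← Complex.mul_conj']
    rfl
  have hrow : ∀ k, ∑ l, c k l * ‖x k‖ ^ 2 ≤ B * ‖x k‖ ^ 2 := fun k => by
    rw [← Finset.sum_mul]
    gcongr
    exact hB k
  calc |Q - ∑ k, D k * ‖x k‖ ^ 2| = ‖((Q - ∑ k, D k * ‖x k‖ ^ 2 : ℝ) : ℂ)‖ := by
        rw [Complex.norm_real, Real.norm_eq_abs]
    _ ≤ ∑ k, ∑ l, ‖x k * star (x l) * (g k l - if k = l then (D k : ℂ) else 0)‖ := by
        rw [hdiff]
        exact (norm_sum_le _ _).trans (Finset.sum_le_sum fun k _ => norm_sum_le _ _)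
    -- AM-GM on `‖x k‖ * ‖x l‖`; by symmetry of `c`, row sums then suffice.
    _ ≤ ∑ k, ∑ l, (c k l * ‖x k‖ ^ 2 / 2 + c l k * ‖x l‖ ^ 2 / 2) := by
        refine Finset.sum_le_sum fun k _ => Finset.sum_le_sum fun l _ => ?_
        rw [norm_mul, norm_mul, norm_star, ← hc k l]
        calc ‖x k‖ * ‖x l‖ * ‖g k l - if k = l then (D k : ℂ) else 0‖
            ≤ ‖x k‖ * ‖x l‖ * c k l := by gcongr; exact hg k l
          _ ≤ _ := by nlinarith [mul_nonneg (hc0 k l) (sq_nonneg (‖x k‖ - ‖x l‖))]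
    _ = ∑ k, ∑ l, c k l * ‖x k‖ ^ 2 := by
        simp only [Finset.sum_add_distrib]
        rw [Finset.sum_comm (f := fun k l => c l k * ‖x l‖ ^ 2 / 2)]
        simp only [← Finset.sum_add_distrib, add_halves]
    _ ≤ ∑ k, B * ‖x k‖ ^ 2 := Finset.sum_le_sum fun k _ => hrow k
    _ = B * ∑ k, ‖x k‖ ^ 2 := by rw [Finset.mul_sum]

theorem norm_geom_sum_le_two_div {ζ : ℂ} (h1 : ζ ≠ 1) (hζ : ‖ζ‖ ≤ 1) (n : ℕ) :
    ‖∑ i ∈ Finset.range n, ζ ^ i‖ ≤ 2 / ‖1 - ζ‖ := by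
  rw [geom_sum_eq h1, norm_div, norm_sub_rev ζ 1]
  gcongr
  calc ‖ζ ^ n - 1‖ ≤ ‖ζ ^ n‖ + ‖(1 : ℂ)‖ := norm_sub_le _ _
    _ ≤ 1 + 1 := by
        rw [norm_pow, norm_one]
        gcongr
        exact pow_le_one₀ (norm_nonneg _) hζ
    _ = 2 := by norm_num

open Finset in
/-- Near-orthogonality of the geometric sequences `n ↦ z k ^ n` with respect to the weight
`n ↦ #{(i, j) | i < L, j < M, i + j = n}`. -/
theorem abs_weighted_sum_sub_diagonal_le {ι : Type*} [Fintype ι] [DecidableEq ι] (z : ι → ℂ)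
    (hz : ∀ k, ‖z k‖ ≤ 1) (hne : ∀ k l, k ≠ l → z k * star (z l) ≠ 1) {B : ℝ}
    (hB : ∀ k, ∑ l, (if k = l then 0 else 4 / ‖1 - z k * star (z l)‖ ^ 2) ≤ B) (L M : ℕ)
    (x : ι → ℂ) :
    |∑ i ∈ range L, ∑ j ∈ range M, ‖∑ k, x k * z k ^ (i + j)‖ ^ 2 -
        ∑ k, (∑ i ∈ range L, (‖z k‖ ^ 2) ^ i) * (∑ j ∈ range M, (‖z k‖ ^ 2) ^ j) * ‖x k‖ ^ 2| ≤
      B * ∑ k, ‖x k‖ ^ 2 := by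
  refine abs_sub_diagonal_le_of_row_sums x
    (fun k l => (∑ i ∈ range L, (z k * star (z l)) ^ i) * ∑ j ∈ range M, (z k * star (z l)) ^ j)
    _ (fun k l => if k = l then 0 else 4 / ‖1 - z k * star (z l)‖ ^ 2) _ _ ?_ ?_ ?_ hB
  · have hexp : ∀ n : ℕ, ((‖∑ k, x k * z k ^ n‖ ^ 2 : ℝ) : ℂ) =
        ∑ k, ∑ l, x k * star (x l) * (z k * star (z l)) ^ n := fun n => by
      push_cast
      rw [← Complex.mul_conj', map_sum, sum_mul_sum]
      refine sum_congr rfl fun k _ => sum_congr rfl fun l _ => ?_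
      simp only [map_mul, map_pow, mul_pow, Complex.star_def]
      ring
    push_cast at hexp ⊢
    have hG : ∀ ζ : ℂ, (∑ i ∈ range L, ζ ^ i) * ∑ j ∈ range M, ζ ^ j =
        ∑ i ∈ range L, ∑ j ∈ range M, ζ ^ (i + j) := fun ζ => by
      simp only [sum_mul_sum, pow_add]
    simp only [hexp, hG]
    simp only [mul_sum]
    calc _ = ∑ i ∈ range L, ∑ k, ∑ j ∈ range M, ∑ l,
            x k * star (x l) * (z k * star (z l)) ^ (i + j) :=
          sum_congr rfl fun i _ => sum_comm
      _ = ∑ k, ∑ i ∈ range L, ∑ j ∈ range M, ∑ l,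
            x k * star (x l) * (z k * star (z l)) ^ (i + j) := sum_comm
      _ = ∑ k, ∑ i ∈ range L, ∑ l, ∑ j ∈ range M,
            x k * star (x l) * (z k * star (z l)) ^ (i + j) :=
          sum_congr rfl fun k _ => sum_congr rfl fun i _ => sum_comm
      _ = _ := sum_congr rfl fun k _ => sum_comm
  · intro k l
    by_cases h : k = l
    · subst h
      have : z k * star (z k) = ((‖z k‖ ^ 2 : ℝ) : ℂ) := by
        push_cast
        exact Complex.mul_conj' _
      rw [this, if_pos rfl, if_pos rfl]
      push_cast
      rw [sub_self, norm_zero]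
    · simp only [if_neg h, sub_zero, norm_mul]
      have hle : ‖z k * star (z l)‖ ≤ 1 := by
        rw [norm_mul, norm_star]
        exact mul_le_one₀ (hz k) (norm_nonneg _) (hz l)
      calc _ ≤ 2 / ‖1 - z k * star (z l)‖ * (2 / ‖1 - z k * star (z l)‖) :=
            mul_le_mul (norm_geom_sum_le_two_div (hne k l h) hle L)
              (norm_geom_sum_le_two_div (hne k l h) hle M) (norm_nonneg _) (by positivity)
        _ = _ := by rw [div_mul_div_comm, ← sq, ← sq]; norm_num
  · intro k l
    simp only [eq_comm (a := k) (b := l)]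
    congr 2
    rw [← norm_star (1 - z k * star (z l))]
    simp [mul_comm]

/-! ### Distances between nodes, and attained singular values -/

/-- The square norm is `(1 - r) ^ 2 + 2 r (1 - cos 2πv)`, and `1 - cos 2πv ≥ 8 v ^ 2` for `|v| ≤ 1 /
2`; the threshold `r ≥ 1 / 8` makes `16 r v ^ 2 ≥ 2 v ^ 2`. -/
theorem sq_le_norm_one_sub_sq {r v : ℝ} (hr : 1 / 8 ≤ r) (hv : |v| ≤ 1 / 2) :
    2 * v ^ 2 ≤ ‖1 - (r : ℂ) * Complex.exp ((2 * Real.pi * v : ℝ) * Complex.I)‖ ^ 2 := by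
  have hcos : Real.cos (2 * Real.pi * v) ≤ 1 - 8 * v ^ 2 := by
    have h : |2 * Real.pi * v| ≤ Real.pi := by
      rw [abs_mul, abs_of_pos (by positivity : 0 < 2 * Real.pi)]
      nlinarith [Real.pi_pos]
    have := Real.cos_le_one_sub_mul_cos_sq h
    have h2 : 2 / Real.pi ^ 2 * (2 * Real.pi * v) ^ 2 = 8 * v ^ 2 := by
      field_simp
      ring
    linarith
  have heq : ‖1 - (r : ℂ) * Complex.exp ((2 * Real.pi * v : ℝ) * Complex.I)‖ ^ 2 =
      (1 - r) ^ 2 + 2 * r * (1 - Real.cos (2 * Real.pi * v)) := by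
    rw [← Complex.normSq_eq_norm_sq, Complex.normSq_apply]
    simp only [Complex.sub_re, Complex.sub_im, Complex.one_re, Complex.one_im, Complex.re_ofReal_mul,
      Complex.im_ofReal_mul, Complex.exp_ofReal_mul_I_re, Complex.exp_ofReal_mul_I_im]
    nlinarith [Real.sin_sq_add_cos_sq (2 * Real.pi * v)]
  rw [heq]
  nlinarith [sq_nonneg (1 - r), sq_nonneg v, mul_nonneg (sub_nonneg.2 hr) (sq_nonneg v)]

/-- An eigenvector of `T* T` attains the singular value, so quadratic bounds valid for all vectors
pass to singular values without a min-max principle. -/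
theorem LinearMap.exists_norm_sq_eq_sq_singularValues {E F : Type*} [NormedAddCommGroup E]
    [InnerProductSpace ℂ E] [FiniteDimensional ℂ E] [NormedAddCommGroup F]
    [InnerProductSpace ℂ F] [FiniteDimensional ℂ F] (T : E →ₗ[ℂ] F) {n : ℕ}
    (hn : n < Module.finrank ℂ E) :
    ∃ v : E, 0 < ‖v‖ ^ 2 ∧ ‖T v‖ ^ 2 = T.singularValues n ^ 2 * ‖v‖ ^ 2 := by
  obtain ⟨v, hv⟩ :=
    (T.hasEigenvalue_adjoint_comp_self_sq_singularValues hn).exists_hasEigenvector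
  refine ⟨v, by have := norm_pos_iff.2 hv.2; positivity, ?_⟩
  have h : inner ℂ v (T.adjoint (T v)) = inner ℂ (T v) (T v) := T.adjoint_inner_right v (T v)
  have h2 : T.adjoint (T v) = ((T.singularValues n ^ 2 : ℝ) : ℂ) • v := by
    simpa using hv.apply_eq_smul
  rw [h2, inner_smul_right] at h
  have h3 := congrArg Complex.re h
  rw [Complex.re_ofReal_mul] at h3
  rw [← inner_self_eq_norm_sq (𝕜 := ℂ), ← inner_self_eq_norm_sq (𝕜 := ℂ)]
  exact h3.symm

theorem norm_dampedNode (Fs d f : ℝ) : ‖dampedNode Fs d f‖ = Real.exp (-d) := by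
  have h : 2 * Real.pi * Complex.I * f / Fs = ((2 * Real.pi * f / Fs : ℝ) : ℂ) * Complex.I := by
    push_cast
    ring
  rw [dampedNode, norm_mul, h, Complex.norm_exp_ofReal_mul_I, ← Complex.ofReal_neg,
    Complex.norm_exp_ofReal, mul_one]

theorem dampedNode_mul_star (Fs d d' f f' : ℝ) (n : ℤ) :
    dampedNode Fs d f * star (dampedNode Fs d' f') = (Real.exp (-(d + d')) : ℂ) *
      Complex.exp ((2 * Real.pi * ((f - f') / Fs - n) : ℝ) * Complex.I) := by
  simp only [dampedNode, Complex.star_def, ← Complex.exp_conj, Complex.ofReal_exp,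
    ← Complex.exp_add, map_add, map_mul, map_neg, map_div₀, Complex.conj_ofReal, Complex.conj_I,
    map_ofNat]
  rw [Complex.exp_eq_exp_iff_exists_int]
  refine ⟨n, ?_⟩
  push_cast
  ring

/-- The wrap-around separation of the frequencies controls the Gram matrix of the sequences
`n ↦ z k ^ n`, up to the damping. -/
theorem dampedNode_row_sum_le {K : ℕ} {Fs δ : ℝ} (hFs : 0 < Fs) (hδ : 0 < δ) {d f : Fin K → ℝ}
    (hd1 : ∀ k, d k ≤ 1)
    (hsep : ∀ (n : ℤ) k l, k ≠ l → δ ≤ |f k - f l + n * Fs|) :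
    (∀ k l, k ≠ l → dampedNode Fs (d k) (f k) * star (dampedNode Fs (d l) (f l)) ≠ 1) ∧
    ∀ k, ∑ l, (if k = l then 0 else
      4 / ‖1 - dampedNode Fs (d k) (f k) * star (dampedNode Fs (d l) (f l))‖ ^ 2) ≤
      8 * (Fs / δ) ^ 2 := by
  -- Signed wrapped differences in units of `Fs`. For fixed `k`, both `v k l` and `v k l - v k m`
  -- are, up to the factor `Fs`, differences of two frequencies modulo `Fs`, hence `δ /
  -- Fs`-separated.
  set v : Fin K → Fin K → ℝ := fun k l => (f k - f l) / Fs - round ((f k - f l) / Fs) with hv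
  have hη : 0 < δ / Fs := by positivity
  have hnorm : ∀ k l, 2 * v k l ^ 2 ≤
      ‖1 - dampedNode Fs (d k) (f k) * star (dampedNode Fs (d l) (f l))‖ ^ 2 := fun k l => by
    rw [dampedNode_mul_star _ _ _ _ _ (round ((f k - f l) / Fs))]
    refine sq_le_norm_one_sub_sq ?_ (abs_sub_round _)
    -- The modulus of the product is at least `e⁻² > 1 / 8`, because each damping factor is at most
    -- `1`.
    have h1 : Real.exp 2 < 8 := by
      have : Real.exp 2 = Real.exp 1 * Real.exp 1 := by rw [← Real.exp_add]; norm_num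
      rw [this]
      nlinarith [Real.exp_one_lt_d9, Real.exp_pos 1]
    rw [one_div, Real.exp_neg]
    gcongr
    exact (Real.exp_le_exp.2 (by linarith [hd1 k, hd1 l])).trans h1.le
  have hscale : ∀ t : ℝ, |t| * Fs = |t * Fs| := fun t => by rw [abs_mul, abs_of_pos hFs]
  have hvle : ∀ k l, k ≠ l → δ / Fs ≤ |v k l| := fun k l hkl => by
    rw [div_le_iff₀ hFs, hscale]
    have h : v k l * Fs = f k - f l + (-round ((f k - f l) / Fs) : ℤ) * Fs := by
      simp only [hv]
      push_cast
      field_simp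
      ring
    rw [h]
    exact hsep _ k l hkl
  have hvsep : ∀ k l m, l ≠ m → δ / Fs ≤ |v k l - v k m| := fun k l m hlm => by
    rw [div_le_iff₀ hFs, hscale]
    have h : (v k l - v k m) * Fs =
        f m - f l + (round ((f k - f m) / Fs) - round ((f k - f l) / Fs) : ℤ) * Fs := by
      simp only [hv]
      push_cast
      field_simp
      ring
    rw [h]
    exact hsep _ m l hlm.symm
  have hvpos : ∀ k l, k ≠ l → 0 < v k l ^ 2 := fun k l hkl => by
    have := hη.trans_le (hvle k l hkl)
    rw [← sq_abs]
    positivity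
  refine ⟨fun k l hkl h => ?_, fun k => ?_⟩
  · have := hnorm k l
    rw [h] at this
    simp only [sub_self, norm_zero] at this
    linarith [hvpos k l hkl]
  · calc ∑ l, (if k = l then 0 else
          4 / ‖1 - dampedNode Fs (d k) (f k) * star (dampedNode Fs (d l) (f l))‖ ^ 2)
        ≤ ∑ l, (if k = l then 0 else 2 * (v k l ^ 2)⁻¹) := by
          refine Finset.sum_le_sum fun l _ => ?_
          split_ifs with hkl
          · rfl
          · have h1 := hvpos k l hkl
            calc _ ≤ 4 / (2 * v k l ^ 2) := by
                  gcongr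
                  exact hnorm k l
              _ = _ := by field_simp; norm_num
      _ = 2 * ∑ l ∈ Finset.univ.erase k, (v k l ^ 2)⁻¹ := by
          rw [Finset.mul_sum, ← Finset.filter_ne, Finset.sum_filter]
          exact Finset.sum_congr rfl fun l _ => by split_ifs <;> simp_all
      _ ≤ 2 * (4 / (δ / Fs) ^ 2) := by
          gcongr
          exact sum_inv_sq_le_of_abs_separated _ _ hη
            (fun l hl => hvle k l (Finset.ne_of_mem_erase hl).symm)
            fun l _ m _ hlm => hvsep k l m hlm
      _ = 8 * (Fs / δ) ^ 2 := by field_simp; norm_num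

/-! ### Comparison of the sharp window with trapezoids -/

open Finset in
theorem sum_range_add_le_sum_range {a : ℕ → ℝ} (ha : ∀ n, 0 ≤ a n) {i M N : ℕ} (h : i + M ≤ N) :
    ∑ j ∈ range M, a (i + j) ≤ ∑ n ∈ range N, a n :=
  calc ∑ j ∈ range M, a (i + j) ≤ ∑ j ∈ range (i + M), a j := by
        rw [sum_range_add]
        exact le_add_of_nonneg_left (sum_nonneg fun j _ => ha j)
    _ ≤ ∑ n ∈ range N, a n :=
        sum_le_sum_of_subset_of_nonneg (range_mono h) fun n _ _ => ha n

-- The tangent bound `e^{-2di} ≥ 1 - 2di`, summed over `i`.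
open Finset in
theorem mul_one_sub_le_geom_sum_exp (d : ℝ) (L : ℕ) :
    L * (1 - d * (L - 1)) ≤ ∑ i ∈ range L, (Real.exp (-d) ^ 2) ^ i := by
  have hsum : (L : ℝ) * (1 - d * (L - 1)) = ∑ i ∈ range L, (1 - 2 * d * i) := by
    induction L with
    | zero => simp
    | succ n ih =>
      rw [sum_range_succ, ← ih]
      push_cast
      ring
  rw [hsum]
  refine sum_le_sum fun i _ => ?_
  rw [← Real.exp_nat_mul, ← Real.exp_nat_mul]
  refine le_trans (le_of_eq ?_) (Real.add_one_le_exp _)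
  push_cast
  ring

-- All `L` translates of a window of length `M` fit inside `[0, N)` when `L + M = N + 1`, so the
-- trapezoid is at most `L` times the sharp window.
open Finset in
theorem le_sum_norm_sq_of_row_sums {ι : Type*} [Fintype ι] [DecidableEq ι] {z : ι → ℂ}
    {d : ι → ℝ} (hd : ∀ k, 0 ≤ d k) (hz : ∀ k, ‖z k‖ = Real.exp (-d k))
    (hne : ∀ k l, k ≠ l → z k * star (z l) ≠ 1) {B : ℝ}
    (hB : ∀ k, ∑ l, (if k = l then 0 else 4 / ‖1 - z k * star (z l)‖ ^ 2) ≤ B)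
    {dmax : ℝ} (hdmax : ∀ k, d k ≤ dmax) {L M N : ℕ} (hL : 1 ≤ L) (hM : 1 ≤ M)
    (hLM : L + M = N + 1) (hdN : dmax * ((N : ℝ) - 1) ≤ 1) (x : ι → ℂ) :
    (M * (1 - dmax * ((N : ℝ) - 1)) - B / L) * ∑ k, ‖x k‖ ^ 2 ≤
      ∑ n ∈ range N, ‖∑ k, x k * z k ^ n‖ ^ 2 := by
  have hL0 : (0 : ℝ) < L := by exact_mod_cast hL
  have hL1 : (1 : ℝ) ≤ L := by exact_mod_cast hL
  have hM1 : (1 : ℝ) ≤ M := by exact_mod_cast hM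
  have hN : (N : ℝ) = L + M - 1 := by
    have : (L : ℝ) + M = N + 1 := by exact_mod_cast hLM
    linarith
  have hz1 : ∀ k, ‖z k‖ ≤ 1 := fun k => by
    rw [hz, Real.exp_le_one_iff]
    linarith [hd k]
  have hmain := (abs_le.1 (abs_weighted_sum_sub_diagonal_le z hz1 hne hB L M x)).1
  have hshift : ∑ i ∈ range L, ∑ j ∈ range M, ‖∑ k, x k * z k ^ (i + j)‖ ^ 2 ≤
      L * ∑ n ∈ range N, ‖∑ k, x k * z k ^ n‖ ^ 2 := by
    rw [← nsmul_eq_mul, ← card_range L, ← sum_const, card_range]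
    refine sum_le_sum fun i hi => ?_
    have := mem_range.1 hi
    exact sum_range_add_le_sum_range (a := fun n => ‖∑ k, x k * z k ^ n‖ ^ 2)
      (fun n => by positivity) (by omega)
  have hdiag : ∀ k, L * M * (1 - dmax * ((N : ℝ) - 1)) ≤
      (∑ i ∈ range L, (‖z k‖ ^ 2) ^ i) * (∑ j ∈ range M, (‖z k‖ ^ 2) ^ j) := fun k => by
    have hk := hd k
    have h0 : d k * (L - 1) + d k * (M - 1) ≤ dmax * (N - 1) := by
      have := mul_le_mul_of_nonneg_right (hdmax k) (by linarith : (0 : ℝ) ≤ N - 1)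
      rw [hN] at this ⊢
      linarith
    have ha : 0 ≤ d k * ((L : ℝ) - 1) := mul_nonneg hk (by linarith)
    have hb : 0 ≤ d k * ((M : ℝ) - 1) := mul_nonneg hk (by linarith)
    -- Since `(L - 1) + (M - 1) = N - 1`, expanding the product and dropping its nonnegative cross
    -- term loses exactly the stated damping factor.
    calc L * M * (1 - dmax * ((N : ℝ) - 1))
        ≤ L * M * ((1 - d k * (L - 1)) * (1 - d k * (M - 1))) := by
          gcongr
          nlinarith
      _ = L * (1 - d k * (L - 1)) * (M * (1 - d k * (M - 1))) := by ring
      _ ≤ _ := by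
          rw [hz]
          refine mul_le_mul (mul_one_sub_le_geom_sum_exp _ _) (mul_one_sub_le_geom_sum_exp _ _)
            (mul_nonneg (by linarith) (by linarith)) (sum_nonneg fun i _ => by positivity)
  have hdiag' : L * M * (1 - dmax * ((N : ℝ) - 1)) * ∑ k, ‖x k‖ ^ 2 ≤
      ∑ k, (∑ i ∈ range L, (‖z k‖ ^ 2) ^ i) * (∑ j ∈ range M, (‖z k‖ ^ 2) ^ j) * ‖x k‖ ^ 2 := by
    rw [mul_sum]
    exact sum_le_sum fun k _ => mul_le_mul_of_nonneg_right (hdiag k) (by positivity)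
  refine le_of_mul_le_mul_left ?_ hL0
  calc L * ((M * (1 - dmax * ((N : ℝ) - 1)) - B / L) * ∑ k, ‖x k‖ ^ 2)
      = L * M * (1 - dmax * ((N : ℝ) - 1)) * ∑ k, ‖x k‖ ^ 2 - B * ∑ k, ‖x k‖ ^ 2 := by
        field_simp
    _ ≤ _ := by linarith

-- The window is moved to `[L, L + N)` and extended by `L` on both sides, so that all `L + 1`
-- translates of a window of length `N + L` cover it. Absorbing the shift into the coefficients
-- costs the factor `e^{2 dmax L}`.
open Finset in
theorem sum_norm_sq_le_of_row_sums {ι : Type*} [Fintype ι] [DecidableEq ι] {z : ι → ℂ}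
    {d : ι → ℝ} (hd : ∀ k, 0 ≤ d k) (hz : ∀ k, ‖z k‖ = Real.exp (-d k))
    (hne : ∀ k l, k ≠ l → z k * star (z l) ≠ 1) {B : ℝ} (hB0 : 0 ≤ B)
    (hB : ∀ k, ∑ l, (if k = l then 0 else 4 / ‖1 - z k * star (z l)‖ ^ 2) ≤ B)
    {dmax : ℝ} (hdmax : ∀ k, d k ≤ dmax) (L N : ℕ) (x : ι → ℂ) :
    ∑ n ∈ range N, ‖∑ k, x k * z k ^ n‖ ^ 2 ≤
      (N + L + B / (L + 1)) * Real.exp (2 * dmax * L) * ∑ k, ‖x k‖ ^ 2 := by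
  have hL0 : (0 : ℝ) < L + 1 := by positivity
  have hz1 : ∀ k, ‖z k‖ ≤ 1 := fun k => by
    rw [hz, Real.exp_le_one_iff]
    linarith [hd k]
  have hz0 : ∀ k, z k ≠ 0 := fun k => by
    rw [← norm_pos_iff, hz]
    positivity
  set y : ι → ℂ := fun k => x k / z k ^ L with hy
  have hxy : ∀ n, ∑ k, x k * z k ^ n = ∑ k, y k * z k ^ (L + n) := fun n =>
    sum_congr rfl fun k _ => by
      have := pow_ne_zero L (hz0 k)
      simp only [hy, pow_add]
      field_simp
  have hynorm : ∑ k, ‖y k‖ ^ 2 ≤ Real.exp (2 * dmax * L) * ∑ k, ‖x k‖ ^ 2 := by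
    rw [mul_sum]
    refine sum_le_sum fun k _ => ?_
    rw [hy, norm_div, norm_pow, hz, ← Real.exp_nat_mul, div_eq_mul_inv, ← Real.exp_neg, mul_pow,
      ← Real.exp_nat_mul, mul_comm]
    refine mul_le_mul_of_nonneg_right (Real.exp_le_exp.2 ?_) (by positivity)
    push_cast
    linarith [mul_le_mul_of_nonneg_right (hdmax k) (Nat.cast_nonneg (α := ℝ) L)]
  have hmain := (abs_le.1 (abs_weighted_sum_sub_diagonal_le z hz1 hne hB (L + 1) (N + L) y)).2
  have hshift : (L + 1) * ∑ n ∈ range N, ‖∑ k, x k * z k ^ n‖ ^ 2 ≤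
      ∑ i ∈ range (L + 1), ∑ j ∈ range (N + L), ‖∑ k, y k * z k ^ (i + j)‖ ^ 2 := by
    have hconst : ((L : ℝ) + 1) * ∑ n ∈ range N, ‖∑ k, x k * z k ^ n‖ ^ 2 =
        ∑ i ∈ range (L + 1), ∑ n ∈ range N, ‖∑ k, x k * z k ^ n‖ ^ 2 := by
      rw [sum_const, card_range, nsmul_eq_mul, Nat.cast_succ]
    rw [hconst]
    refine sum_le_sum fun i hi => ?_
    have hi' := mem_range.1 hi
    -- Starting at `j = L - i`, the `i`-th translate contains the shifted window: `i + j` runs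
    -- through `[L, L + N)`.
    refine le_trans (le_of_eq (sum_congr rfl fun n _ => ?_)) (sum_range_add_le_sum_range
      (a := fun j => ‖∑ k, y k * z k ^ (i + j)‖ ^ 2) (i := L - i) (M := N)
      (fun n => by positivity) (by omega))
    rw [hxy, ← add_assoc, Nat.add_sub_cancel' (by omega)]
  have hgeom : ∀ k, ∀ n : ℕ, ∑ i ∈ range n, (‖z k‖ ^ 2) ^ i ≤ n := fun k n => by
    calc _ ≤ ∑ i ∈ range n, (1 : ℝ) :=
          sum_le_sum fun i _ => pow_le_one₀ (by positivity) (pow_le_one₀ (norm_nonneg _) (hz1 k))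
      _ = n := by simp
  have hdiag : ∑ k, (∑ i ∈ range (L + 1), (‖z k‖ ^ 2) ^ i) *
      (∑ j ∈ range (N + L), (‖z k‖ ^ 2) ^ j) * ‖y k‖ ^ 2 ≤
      (L + 1) * (N + L) * ∑ k, ‖y k‖ ^ 2 := by
    rw [mul_sum]
    refine sum_le_sum fun k _ => mul_le_mul_of_nonneg_right ?_ (by positivity)
    refine mul_le_mul ?_ ?_ (sum_nonneg fun i _ => by positivity) hL0.le
    · exact_mod_cast hgeom k (L + 1)
    · exact_mod_cast hgeom k (N + L)
  refine le_of_mul_le_mul_left ?_ hL0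
  calc _ ≤ (L + 1) * (N + L) * ∑ k, ‖y k‖ ^ 2 + B * ∑ k, ‖y k‖ ^ 2 := by linarith
    _ = ((L + 1) * (N + L) + B) * ∑ k, ‖y k‖ ^ 2 := by ring
    _ ≤ ((L + 1) * (N + L) + B) * (Real.exp (2 * dmax * L) * ∑ k, ‖x k‖ ^ 2) := by gcongr
    _ = _ := by field_simp

/-! ### Singular values of the Vandermonde matrix and choice of `L` -/

theorem norm_sq_toLpLin_vandermondeMatrix {K : ℕ} (N : ℕ) (z : Fin K → ℂ)
    (x : EuclideanSpace ℂ (Fin K)) :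
    ‖Matrix.toLpLin 2 2 (vandermondeMatrix N z) x‖ ^ 2 =
      ∑ n ∈ Finset.range N, ‖∑ k, x k * z k ^ n‖ ^ 2 := by
  rw [EuclideanSpace.norm_sq_eq, Finset.sum_range]
  refine Finset.sum_congr rfl fun n _ => ?_
  congr 2
  simp [Matrix.toLpLin_apply, Matrix.mulVec, dotProduct, vandermondeMatrix, mul_comm]

theorem sigmaMax_sq_le {M N : ℕ} (hN : 0 < N) (A : Matrix (Fin M) (Fin N) ℂ) {C : ℝ}
    (h : ∀ x, ‖Matrix.toLpLin 2 2 A x‖ ^ 2 ≤ C * ‖x‖ ^ 2) : sigmaMax A ^ 2 ≤ C := by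
  obtain ⟨v, hv, he⟩ := (Matrix.toLpLin 2 2 A).exists_norm_sq_eq_sq_singularValues
    (n := 0) (by simpa using hN)
  exact le_of_mul_le_mul_right (he ▸ h v) hv

theorem le_sigmaMin_sq {M N : ℕ} (hN : 0 < N) (A : Matrix (Fin M) (Fin N) ℂ) {c : ℝ}
    (h : ∀ x, c * ‖x‖ ^ 2 ≤ ‖Matrix.toLpLin 2 2 A x‖ ^ 2) : c ≤ sigmaMin A ^ 2 := by
  obtain ⟨v, hv, he⟩ := (Matrix.toLpLin 2 2 A).exists_norm_sq_eq_sq_singularValues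
    (n := min M N - 1) (by simp; omega)
  exact le_of_mul_le_mul_right (he ▸ h v) hv

theorem theorem2 (K N : ℕ) (hK : 2 ≤ K) (hN : 2 ≤ N) (Fs : ℝ) (hFs : 0 < Fs)
    (d f : Fin K → ℝ) (hd : ∀ k, 0 ≤ d k) (hf : ∀ k, f k ∈ Set.Ico 0 Fs)
    (δ dmax : ℝ) (hδ : IsLeast (wrapDistances Fs f) δ) (hdmax : IsGreatest (Set.range d) dmax)
    (hdmax_lt : dmax < 1 / ((N : ℝ) - 1))
    (hδ_gt : 84 * Fs / (Real.pi * ((N : ℝ) - 1) * (1 - dmax * ((N : ℝ) - 1))) < δ) :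
    ((N : ℝ) - 1) * (1 - dmax * ((N : ℝ) - 1)) - 84 * Fs / (Real.pi * δ) ≤
        sigmaMin (vandermondeMatrix N fun k => dampedNode Fs (d k) (f k)) ^ 2 ∧
      sigmaMax (vandermondeMatrix N fun k => dampedNode Fs (d k) (f k)) ^ 2 ≤
        (N : ℝ) - 1 + 84 * Fs / (Real.pi * δ) ∧
      0 < sigmaMin (vandermondeMatrix N fun k => dampedNode Fs (d k) (f k)) ∧
      condNumber (vandermondeMatrix N fun k => dampedNode Fs (d k) (f k)) ≤
        Real.sqrt (((N : ℝ) - 1 + 84 * Fs / (Real.pi * δ)) /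
          (((N : ℝ) - 1) * (1 - dmax * ((N : ℝ) - 1)) - 84 * Fs / (Real.pi * δ))) := by
  have hN2 : (2 : ℝ) ≤ N := by exact_mod_cast hN
  have hdle : ∀ k, d k ≤ dmax := fun k => hdmax.2 ⟨k, rfl⟩
  have hdmax0 : 0 ≤ dmax := (hd ⟨0, by omega⟩).trans (hdle _)
  set A : ℝ := (N : ℝ) - 1 with hA
  have hA1 : 1 ≤ A := by linarith
  have hdA : dmax * A < 1 := by rwa [lt_div_iff₀ (by linarith)] at hdmax_lt
  have hd1 : ∀ k, d k ≤ 1 := fun k => by nlinarith [hdle k]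
  have hpi := Real.pi_pos
  have hs : 0 < 1 - dmax * A := by linarith
  have hδ0 : 0 < δ := lt_of_le_of_lt (by positivity) hδ_gt
  have hsep : ∀ (n : ℤ) k l, k ≠ l → δ ≤ |f k - f l + n * Fs| := fun n k l hkl =>
    hδ.2 ⟨n, k, l, hkl, rfl⟩
  have hδFs : δ ≤ Fs := by
    have h := hsep 0 ⟨0, by omega⟩ ⟨1, by omega⟩ (by simp)
    have h0 := hf ⟨0, by omega⟩
    have h1 := hf ⟨1, by omega⟩
    simp only [Set.mem_Ico] at h0 h1
    refine h.trans (abs_le.2 ⟨?_, ?_⟩) <;> push_cast <;> linarith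
  obtain ⟨hne, hrow⟩ := dampedNode_row_sum_le hFs hδ0 hd1 hsep
  set y : ℝ := Fs / δ with hy
  have hy1 : 1 ≤ y := (one_le_div hδ0).2 hδFs
  set W : ℝ := 84 * Fs / (Real.pi * δ) with hW
  -- `84 / π > 26`; only this integer multiple of `Fs / δ` is used afterwards.
  have hWy : 26 * y ≤ W := by
    have : W = 84 / Real.pi * y := by
      rw [hW, hy]
      field_simp
    rw [this]
    gcongr
    rw [le_div_iff₀ hpi]
    linarith [Real.pi_lt_d2]
  have hWA : W < A * (1 - dmax * A) := by
    rw [hW, div_lt_iff₀ (by positivity)]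
    rw [div_lt_iff₀ (by positivity)] at hδ_gt
    linarith
  have hyA : 26 * y ≤ A := by nlinarith [mul_nonneg hdmax0 (by linarith : 0 ≤ A)]
  -- With trapezoid height `L + 1 = ⌈y⌉`, the edge loss `L` is at most `y` and the Schur error `8 y
  -- ^ 2 / (L + 1)` at most `8 y`.
  set L : ℕ := ⌈y⌉₊ - 1 with hL
  have hceil : L + 1 = ⌈y⌉₊ := Nat.sub_add_cancel (Nat.ceil_pos.2 (by linarith))
  have hyL : y ≤ L + 1 := by
    have := Nat.le_ceil y
    rw [← hceil] at this
    exact_mod_cast this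
  have hLy : (L : ℝ) ≤ y := by
    have := Nat.ceil_lt_add_one (by linarith : 0 ≤ y)
    rw [← hceil] at this
    push_cast at this
    linarith
  have hLN : L + 1 ≤ N := by
    have : (L : ℝ) + 1 ≤ N := by linarith
    exact_mod_cast this
  have hBL : 8 * y ^ 2 / ((L : ℝ) + 1) ≤ 8 * y := by
    rw [div_le_iff₀ (by positivity)]
    nlinarith
  set z : Fin K → ℂ := fun k => dampedNode Fs (d k) (f k) with hz
  have hznorm : ∀ k, ‖z k‖ = Real.exp (-d k) := fun k => norm_dampedNode _ _ _
  have hlow : A * (1 - dmax * A) - W ≤ sigmaMin (vandermondeMatrix N z) ^ 2 := by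
    refine le_sigmaMin_sq (by omega) _ fun x => ?_
    rw [norm_sq_toLpLin_vandermondeMatrix, EuclideanSpace.norm_sq_eq]
    refine le_trans ?_ (le_sum_norm_sq_of_row_sums hd hznorm hne hrow hdle (L := L + 1)
      (M := N - L) (by omega) (by omega) (by omega) hdA.le x)
    refine mul_le_mul_of_nonneg_right ?_ (by positivity)
    push_cast [Nat.cast_sub (by omega : L ≤ N)]
    have hLs : L * (1 - dmax * A) ≤ y := by
      nlinarith [mul_nonneg (Nat.cast_nonneg (α := ℝ) L) (mul_nonneg hdmax0 (by linarith : 0 ≤ A))]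
    have : ((N : ℝ) - L) * (1 - dmax * A) =
      A * (1 - dmax * A) + (1 - dmax * A) - L * (1 - dmax * A) := by
      rw [hA]
      ring
    rw [← hA, this]
    linarith
  have hupp : sigmaMax (vandermondeMatrix N z) ^ 2 ≤ A + W := by
    refine sigmaMax_sq_le (by omega) _ fun x => ?_
    rw [norm_sq_toLpLin_vandermondeMatrix, EuclideanSpace.norm_sq_eq]
    refine (sum_norm_sq_le_of_row_sums hd hznorm hne (by positivity) hrow hdle L N x).trans ?_
    gcongr
    have hA0 : 0 < A - 2 * y := by linarith
    have hdL : dmax * L ≤ y / A := by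
      rw [le_div_iff₀ (by linarith)]
      nlinarith [mul_nonneg hdmax0 (by linarith : 0 ≤ A)]
    -- From `dmax < 1 / A` and `L ≤ y`, the exponent is at most `2 y / A`; then `e^{-t} ≥ 1 - t` is
    -- inverted.
    have hexp : Real.exp (2 * dmax * L) ≤ A / (A - 2 * y) := by
      have h1 := Real.add_one_le_exp (-(2 * dmax * L))
      have h2 : (A - 2 * y) / A ≤ Real.exp (-(2 * dmax * L)) := by
        rw [sub_div, div_self (by linarith), mul_div_assoc]
        linarith
      rw [Real.exp_neg] at h2
      have := inv_anti₀ (by positivity) h2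
      rwa [inv_inv, inv_div] at this
    calc (N + L + 8 * y ^ 2 / (L + 1)) * Real.exp (2 * dmax * L)
        ≤ (A + 1 + y + 8 * y) * (A / (A - 2 * y)) := by
          gcongr
          linarith
      _ ≤ A + 26 * y := by
          -- After clearing the denominator the claim is `52 y ^ 2 ≤ A (15 y - 1)`, which follows
          -- from `A ≥ 26 y` and `y ≥ 1`.
          rw [← mul_div_assoc, div_le_iff₀ hA0]
          nlinarith
      _ ≤ A + W := by linarith
  have hmin0 : 0 ≤ sigmaMin (vandermondeMatrix N z) := LinearMap.singularValues_nonneg _ _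
  have hc : 0 < A * (1 - dmax * A) - W := by linarith
  refine ⟨hlow, hupp, ?_, ?_⟩
  · exact hmin0.lt_of_ne' (sq_pos_iff.1 (hc.trans_le hlow))
  · refine Real.le_sqrt_of_sq_le ?_
    rw [condNumber, div_pow]
    gcongr
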